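/- Let $X$ be a nontrivial Peano space, i.e. a compact, connected, locally connected metric space with more than one point, and let $C(X)$ be the space of nonempty compact subsets of $X$ with the Hausdorff metric $d_H$. Let $F : X \multimap X$ be a set valued map, i.e. a relation $F\subset X\times X$ such that $F(x)=\{y : (x,y)\in F\}$ is nonempty for every $x$. Put $F^0=\mathrm{id}_X$, $F^{n+1}=F\circ F^n$ and $F^{-n}=(F^{-1})^n$ for $n\ge 0$, where $F^{-1}=\{(y,x):(x,y)\in F\}$. Assume that every $F(x)$ is closed, that $x\mapsto F(x)$ is continuous for $d_H$, and that $F$ is positively expansive with constant of expansiveness $\alpha>0$: $F$ is surjective ($\bigcup_x F(x)=X$), and for all $x\neq y$ in $X$ there is an integer $n\ge 0$ with $d_H(F^n(x),F^n(y))>\alpha$. A sub-orbit of $F$ is a sequence $(x_i)_{i\in\mathbb Z}$ with $x_{i+1}\in F(x_i)$ for all $i$, and an $n$-segment is the restriction $(x_0,\dots,x_{n-1})$ of a sub-orbit. A set $A$ of $n$-segments is $(n,\varepsilon)$-separated if any two distinct members $(x_i)$, $(y_i)$ of $A$ satisfy $\mathrm{dist}(x_i,y_i)>\varepsilon$ for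 at least one $i$; $s_n(\varepsilon)$ is the greatest cardinality of an $(n,\varepsilon)$-separated set, and the topological entropy of $F$ is $$h_{top}(F)=\lim_{\varepsilon\to0^+}\limsup_{n\to\infty}\frac1n\log s_n(\varepsilon)\in[0,\infty].$$ Then $h_{top}(F)>0$, provided that one of the following conditions holds: 1. $F(x)$ is a continuum (a nonempty compact connected set) for every $x\in X$; or 2. the family $\mathcal D(X)=\{K\in C(X) : \exists x\in X,\ \exists n\in\mathbb Z,\ F^n(x)=K\}$ is closed in $C(X)$, or its forward part $\{K\in C(X) : \exists x\in X,\ \exists n\ge 0,\ F^n(x)=K\}$ is closed in $C(X)$. -/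

import Mathlib

open Filter Topology TopologicalSpace

namespace SetValued

variable {X : Type*}

/-- The value `F(x) = {y : (x, y) ∈ F}` of a relation `F ⊆ X × X` at a point. -/
def val (F : SetRel X X) (x : X) : Set X := {y | (x, y) ∈ F}

/-- `F` is a set valued map: `F(x) ≠ ∅` for every `x`. -/
def IsSetValuedMap (F : SetRel X X) : Prop := ∀ x, (val F x).Nonempty

/-- `F` is a surjective set valued map: both `F` and its inverse relation are set valued maps. -/
def IsSurjective (F : SetRel X X) : Prop := IsSetValuedMap F ∧ IsSetValuedMap F.inv

/-- Nonnegative iterates: `F⁰` is the identity, and `Fⁿ⁺¹ = F ∘ Fⁿ` (first `Fⁿ`, then `F`;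
`SetRel.comp` lists the relation that is applied first on the left). -/
def iter (F : SetRel X X) : ℕ → SetRel X X
  | 0 => SetRel.id
  | n + 1 => (iter F n).comp F

/-- Integer iterates, with `F⁻ⁿ = (F⁻¹)ⁿ`. -/
def zIter (F : SetRel X X) : ℤ → SetRel X X
  | Int.ofNat n => iter F n
  | Int.negSucc n => iter F.inv (n + 1)

/-- The sub-orbits of `F`: bi-infinite sequences with `(xᵢ, xᵢ₊₁) ∈ F` for all `i`. -/
def suborbits (F : SetRel X X) : Set (ℤ → X) := {ω | ∀ i : ℤ, (ω i, ω (i + 1)) ∈ F}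

/-- The segments `(x₀, …, xₙ₋₁)` of sub-orbits of `F`. -/
def segments (F : SetRel X X) (n : ℕ) : Set (Fin n → X) :=
  {s | ∃ ω ∈ suborbits F, ∀ i : Fin n, s i = ω (i : ℕ)}

section Metric

variable [MetricSpace X]

/-- A continuum: a nonempty compact connected set (a single point is allowed). -/
def IsContinuum (K : Set X) : Prop := IsCompact K ∧ IsConnected K

/-- Continuity of `x ↦ F(x)` with respect to the Hausdorff distance. -/
def IsHausdorffContinuous (F : SetRel X X) : Prop :=
  ∀ x : X, ∀ ε > 0, ∃ δ > 0, ∀ x' : X, dist x x' < δ →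
    Metric.hausdorffDist (val F x) (val F x') < ε

/-- `F` is positively expansive with constant of expansiveness `α`: it is a surjective set valued
map, and any two distinct points have images under some `Fⁿ`, `n ≥ 0`, at Hausdorff distance
greater than `α > 0`. -/
structure IsPositivelyExpansive (F : SetRel X X) (α : ℝ) : Prop where
  surjective : IsSurjective F
  pos : 0 < α
  separates : ∀ x y : X, x ≠ y →
    ∃ n : ℕ, α < Metric.hausdorffDist (val (iter F n) x) (val (iter F n) y)

/-- The family `𝒟(X)` of those nonempty compact sets that are of the form `Fⁿ(x)` with `x ∈ X` and
`n ∈ ℤ`, as a subset of the space `C(X)` of nonempty compact sets with the Hausdorff metric. -/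
def iterateImages (F : SetRel X X) : Set (NonemptyCompacts X) :=
  {K | ∃ (x : X) (n : ℤ), val (zIter F n) x = (K : Set X)}

/-- The forward part of `𝒟(X)`: the nonempty compact sets `Fⁿ(x)` with `x ∈ X` and `n ≥ 0`. -/
def forwardImages (F : SetRel X X) : Set (NonemptyCompacts X) :=
  {K | ∃ (x : X) (n : ℕ), val (iter F n) x = (K : Set X)}

/-- A set of `n`-segments is `(n, ε)`-separated if any two distinct members of it are at distance
greater than `ε` at some time. -/
def IsSeparated (F : SetRel X X) (n : ℕ) (ε : ℝ) (A : Set (Fin n → X)) : Prop :=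
  A ⊆ segments F n ∧ ∀ s ∈ A, ∀ t ∈ A, s ≠ t → ∃ i, ε < dist (s i) (t i)

/-- `sₙ(ε)`: the greatest cardinality of an `(n, ε)`-separated set. -/
noncomputable def maxSeparated (F : SetRel X X) (n : ℕ) (ε : ℝ) : ℕ∞ :=
  ⨆ (A : Set (Fin n → X)) (_ : IsSeparated F n ε A), A.encard

/-- `limsup_{n → ∞} (1/n) log sₙ(ε)`. -/
noncomputable def separatedGrowth (F : SetRel X X) (ε : ℝ) : EReal :=
  limsup (fun n : ℕ => ENNReal.log (maxSeparated F n ε : ENNReal) / (n : EReal)) atTop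

/-- The topological entropy `lim_{ε → 0⁺} limsup_{n → ∞} (1/n) log sₙ(ε) ∈ [-∞, ∞]`. The limit
exists, see `tendsto_separatedGrowth`. -/
noncomputable def topEntropy (F : SetRel X X) : EReal :=
  limUnder (𝓝[>] (0 : ℝ)) (separatedGrowth F)

theorem maxSeparated_antitone (F : SetRel X X) (n : ℕ) : Antitone (maxSeparated F n) := by
  intro ε ε' h
  refine iSup₂_le fun A hA => ?_
  refine le_iSup₂_of_le A ⟨hA.1, fun s hs t ht hst => ?_⟩ le_rfl
  obtain ⟨i, hi⟩ := hA.2 s hs t ht hst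
  exact ⟨i, h.trans_lt hi⟩

theorem separatedGrowth_antitone (F : SetRel X X) : Antitone (separatedGrowth F) := by
  intro ε ε' h
  refine limsup_le_limsup (Eventually.of_forall fun n => ?_)
  refine EReal.monotone_div_right_of_nonneg n.cast_nonneg' (ENNReal.log_monotone ?_)
  exact ENat.toENNReal_le.2 (maxSeparated_antitone F n h)

/-- The limit in the definition of the topological entropy exists. -/
theorem tendsto_separatedGrowth (F : SetRel X X) :
    Tendsto (separatedGrowth F) (𝓝[>] (0 : ℝ)) (𝓝 (topEntropy F)) :=
  tendsto_nhds_limUnder ⟨_, (separatedGrowth_antitone F).tendsto_nhdsGT 0⟩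

end Metric

end SetValued

/-! Continua get stretched and then doubled. Let a continuum `A` contain `x`, `y` at distance at
least `α / 3`. By compactness there is a uniform `N` such that, for some `n ≤ N` and up to swapping,
some `z ∈ Fⁿ(x)` is farther than `α` from all of `Fⁿ(y)`. Values of `F` may be disconnected, yet
lower semicontinuity forces the component of `(x, z)` in the graph of `Fⁿ` over `A` to reach the
fibre over `y` (`exists_continuum_image`). So `Fⁿ(A)` contains a continuum through `z` and some `w ∈
Fⁿ(y)`.

Boundary bumping at `z` and `w` cuts out two continua, again of size at least `α / 3` and more than
`α / 4` apart (`exists_two_continua`). Iteration gives a binary tree: `2 ^ k` orbits that are `α /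
4`-separated up to time `k * N`, hence entropy at least `log 2 / (N + 1)`. -/

namespace SetValued

/-! ### Boundary bumping and continua in images -/

section Continua

/-- In a compact set `D`, either some clopen part of `D` separates `p` from `C`, or a continuum
in `D` joins `p` to `C`. -/
theorem exists_isPreconnected_inter_nonempty {Y : Type*} [TopologicalSpace Y] [T2Space Y]
    {D C : Set Y} {p : Y} (hD : IsCompact D) (hp : p ∈ D) (hC : IsClosed C)
    (h : ∀ Q ⊆ D, p ∈ Q → IsClosed Q → IsClosed (D \ Q) → (Q ∩ C).Nonempty) :
    ∃ K ⊆ D, IsClosed K ∧ IsPreconnected K ∧ p ∈ K ∧ (K ∩ C).Nonempty := by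
  have : CompactSpace D := isCompact_iff_compactSpace.1 hD
  let p' : D := ⟨p, hp⟩
  have hcl : ∀ T : Set D, IsClosed T → IsClosed (Subtype.val '' T) := fun T hT =>
    hD.isClosed.isClosedEmbedding_subtypeVal.isClosedMap T hT
  refine ⟨Subtype.val '' connectedComponent p', by simp, hcl _ isClosed_connectedComponent,
    isPreconnected_connectedComponent.image _ continuous_subtype_val.continuousOn,
    ⟨p', mem_connectedComponent, rfl⟩, ?_⟩
  -- In a compact Hausdorff space the component of `p'` is the intersection of its clopen
  -- neighbourhoods, a directed family, so compactness passes the meeting with `C` to the limit.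
  have hne : (⋂ s : { s : Set D // IsClopen s ∧ p' ∈ s },
      (s : Set D) ∩ Subtype.val ⁻¹' C).Nonempty := by
    have hi : Nonempty { s : Set D // IsClopen s ∧ p' ∈ s } := ⟨⟨Set.univ, isClopen_univ, trivial⟩⟩
    have hclosed : ∀ s : { s : Set D // IsClopen s ∧ p' ∈ s },
        IsClosed ((s : Set D) ∩ Subtype.val ⁻¹' C) := fun s =>
      s.2.1.isClosed.inter (hC.preimage continuous_subtype_val)
    refine IsCompact.nonempty_iInter_of_directed_nonempty_isCompact_isClosed _ ?_ ?_
      (fun s => (hclosed s).isCompact) hclosed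
    · intro s t
      exact ⟨⟨s.1 ∩ t.1, s.2.1.inter t.2.1, s.2.2, t.2.2⟩,
        Set.inter_subset_inter_left _ Set.inter_subset_left,
        Set.inter_subset_inter_left _ Set.inter_subset_right⟩
    · rintro ⟨s, hs, hps⟩
      have hdiff : D \ Subtype.val '' s = Subtype.val '' sᶜ := by
        ext y
        constructor
        · rintro ⟨hy, hys⟩
          exact ⟨⟨y, hy⟩, fun hm => hys ⟨_, hm, rfl⟩, rfl⟩
        · rintro ⟨z, hz, rfl⟩
          refine ⟨z.2, ?_⟩
          rintro ⟨w, hw, hwz⟩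
          exact hz (Subtype.ext hwz ▸ hw)
      obtain ⟨_, ⟨w, hw, rfl⟩, hwC⟩ := h (Subtype.val '' s) (by simp) ⟨p', hps, rfl⟩
        (hcl _ hs.isClosed) (hdiff ▸ hcl _ hs.compl.isClosed)
      exact ⟨w, hw, hwC⟩
  obtain ⟨w, hw⟩ := hne
  rw [Set.mem_iInter] at hw
  refine ⟨w, ⟨w, ?_, rfl⟩, (hw ⟨Set.univ, isClopen_univ, trivial⟩).2⟩
  rw [connectedComponent_eq_iInter_isClopen, Set.mem_iInter]
  exact fun s => (hw s).1

/-- Boundary bumping: a continuum that leaves a ball around one of its points contains a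
continuum that joins this point to the boundary of the ball. -/
theorem exists_subcontinuum_closedBall {X : Type*} [MetricSpace X] {A : Set X} {p q : X} {r : ℝ}
    (hAc : IsCompact A) (hA : IsPreconnected A) (hp : p ∈ A) (hq : q ∈ A) (hr : 0 < r)
    (hpq : r < dist p q) :
    ∃ K ⊆ A, IsClosed K ∧ IsPreconnected K ∧ K ⊆ Metric.closedBall p r ∧ p ∈ K ∧
      ∃ y ∈ K, r ≤ dist p y := by
  have hC : IsClosed {y | r ≤ dist p y} :=
    isClosed_le continuous_const (continuous_const.dist continuous_id)
  obtain ⟨K, hK, hKc, hKp, hpK, y, hyK, hy⟩ := exists_isPreconnected_inter_nonempty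
    (D := A ∩ Metric.closedBall p r) (p := p) (hAc.inter_right Metric.isClosed_closedBall)
    ⟨hp, Metric.mem_closedBall_self hr.le⟩ hC (by
      intro Q hQ hpQ hQc hQd
      by_contra hne
      have hlt : ∀ y ∈ Q, dist p y < r := fun y hy =>
        lt_of_not_ge fun hle => hne ⟨y, hy, hle⟩
      obtain ⟨y, -, hy, hy'⟩ := isPreconnected_closed_iff.1 hA Q
        ((A ∩ Metric.closedBall p r) \ Q ∪ {y | r ≤ dist p y}) hQc (hQd.union hC)
        (by
          intro a ha
          by_cases haQ : a ∈ Q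
          · exact Or.inl haQ
          rcases le_total r (dist p a) with h | h
          · exact Or.inr (Or.inr h)
          · exact Or.inr (Or.inl ⟨⟨ha, by rwa [Metric.mem_closedBall, dist_comm]⟩, haQ⟩))
        ⟨p, hp, hpQ⟩ ⟨q, hq, Or.inr hpq.le⟩
      rcases hy' with hy' | hy'
      · exact hy'.2 hy
      · exact absurd (hlt y hy) (not_lt.2 hy'))
  exact ⟨K, fun y hy => (hK hy).1, hKc, hKp, fun y hy => (hK hy).2, hpK, y, hyK, hy⟩

/-- A relation is lower semicontinuous if the preimages of open sets are open. -/
def IsLowerSemicontinuousRel {X Y : Type*} [TopologicalSpace X] [TopologicalSpace Y]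
    (R : SetRel X Y) : Prop :=
  ∀ V : Set Y, IsOpen V → IsOpen {x | ∃ y ∈ V, (x, y) ∈ R}

/-- The first projection restricted to a lower semicontinuous relation is open. -/
theorem IsLowerSemicontinuousRel.isOpen_dom {X Y : Type*} [TopologicalSpace X]
    [TopologicalSpace Y] {R : SetRel X Y} (hR : IsLowerSemicontinuousRel R) {O : Set (X × Y)}
    (hO : IsOpen O) : IsOpen {x | ∃ y, (x, y) ∈ O ∧ (x, y) ∈ R} := by
  rw [isOpen_iff_mem_nhds]
  rintro x ⟨y, hxy, hR'⟩
  obtain ⟨U, V, hU, hV, hxU, hyV, hUV⟩ := isOpen_prod_iff.1 hO x y hxy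
  filter_upwards [hU.mem_nhds hxU, (hR V hV).mem_nhds ⟨y, hyV, hR'⟩] with x' hx' hx''
  obtain ⟨y', hy', hxy'⟩ := hx''
  exact ⟨y', hUV ⟨hx', hy'⟩, hxy'⟩

theorem IsLowerSemicontinuousRel.comp {X Y Z : Type*} [TopologicalSpace X] [TopologicalSpace Y]
    [TopologicalSpace Z] {R : SetRel X Y} {S : SetRel Y Z} (hR : IsLowerSemicontinuousRel R)
    (hS : IsLowerSemicontinuousRel S) : IsLowerSemicontinuousRel (R.comp S) := by
  intro V hV
  convert hR _ (hS V hV) using 1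
  ext x
  constructor
  · rintro ⟨z, hz, y, hxy, hyz⟩
    exact ⟨y, ⟨z, hz, hyz⟩, hxy⟩
  · rintro ⟨y, ⟨z, hz, hyz⟩, hxy⟩
    exact ⟨z, hz, y, hxy, hyz⟩

/-- The image of a continuum under a closed lower semicontinuous relation contains a continuum
through any prescribed point of a value that reaches any other prescribed value. -/
theorem exists_continuum_image {X Y : Type*} [TopologicalSpace X] [T2Space X]
    [TopologicalSpace Y] [T2Space Y] [CompactSpace Y] {R : SetRel X Y}
    (hRc : IsClosed (R : Set (X × Y))) (hR : IsLowerSemicontinuousRel R) {A : Set X}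
    (hAc : IsCompact A) (hA : IsPreconnected A) {x y : X} {z : Y} (hx : x ∈ A) (hy : y ∈ A)
    (hz : (x, z) ∈ R) :
    ∃ K : Set Y, IsCompact K ∧ IsPreconnected K ∧ (∀ w ∈ K, ∃ a ∈ A, (a, w) ∈ R) ∧ z ∈ K ∧
      ∃ w ∈ K, (y, w) ∈ R := by
  have hD : IsCompact (A ×ˢ (Set.univ : Set Y) ∩ R) := (hAc.prod isCompact_univ).inter_right hRc
  obtain ⟨K, hK, hKc, hKp, hpK, q, hqK, hqy⟩ := exists_isPreconnected_inter_nonempty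
    (p := (x, z)) hD ⟨⟨hx, trivial⟩, hz⟩ (C := Prod.fst ⁻¹' {y})
    (isClosed_singleton.preimage continuous_fst) (by
      intro Q hQ hpQ hQc hQd
      by_contra hne
      have hQcomp : IsCompact Q := hD.of_isClosed_subset hQc hQ
      -- Within `A` the first set is the projection of `Q`: open by lower semicontinuity, as `D \ Q`
      -- is closed. Its complement is open as `Q` is compact. They would disconnect `A`, with `x`
      -- and `y` on different sides.
      obtain ⟨a, haA, ⟨w, hw, hwR⟩, ha⟩ := hA
        {a | ∃ w, (a, w) ∈ ((A ×ˢ (Set.univ : Set Y) ∩ R) \ Q)ᶜ ∧ (a, w) ∈ R} (Prod.fst '' Q)ᶜ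
        (hR.isOpen_dom hQd.isOpen_compl) (hQcomp.image continuous_fst).isClosed.isOpen_compl
        (by
          intro a _
          by_cases ha : a ∈ Prod.fst '' Q
          · obtain ⟨⟨_, w⟩, hw, rfl⟩ := ha
            exact Or.inl ⟨w, fun h => h.2 hw, (hQ hw).2⟩
          · exact Or.inr ha)
        ⟨x, hx, z, fun h => h.2 hpQ, hz⟩
        ⟨y, hy, by
          rintro ⟨q, hq, hqy⟩
          exact hne ⟨q, hq, hqy⟩⟩
      refine hw ⟨⟨⟨haA, trivial⟩, hwR⟩, fun hq => ha ⟨_, hq, rfl⟩⟩)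
  refine ⟨Prod.snd '' K, (hD.of_isClosed_subset hKc hK).image continuous_snd,
    hKp.image _ continuous_snd.continuousOn, ?_, ⟨_, hpK, rfl⟩, q.2,
    ⟨q, hqK, rfl⟩, ?_⟩
  swap
  · have hq : q.1 = y := hqy
    rw [← hq]
    exact (hK hqK).2
  rintro _ ⟨⟨a, w⟩, ha, rfl⟩
  exact ⟨a, (hK ha).1.1, (hK ha).2⟩

end Continua

/-! ### Semicontinuity of iterates and uniform expansiveness -/

section Iterates

variable {X : Type*}

theorem isClosed_iter [TopologicalSpace X] [T2Space X] [CompactSpace X] {F : SetRel X X}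
    (hF : IsClosed (F : Set (X × X))) (n : ℕ) : IsClosed (iter F n : Set (X × X)) := by
  induction n with
  | zero => exact isClosed_diagonal
  | succ n ih =>
    have hcl : IsClosed {q : X × X × X | (q.1, q.2.1) ∈ iter F n ∧ (q.2.1, q.2.2) ∈ F} :=
      (ih.preimage (by fun_prop : Continuous fun q : X × X × X => (q.1, q.2.1))).inter
        (hF.preimage (by fun_prop : Continuous fun q : X × X × X => (q.2.1, q.2.2)))
    have himg := (hcl.isCompact.image
      (by fun_prop : Continuous fun q : X × X × X => (q.1, q.2.2))).isClosed
    convert himg using 1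
    ext ⟨x, z⟩
    constructor
    · rintro ⟨y, hxy, hyz⟩
      exact ⟨(x, y, z), ⟨hxy, hyz⟩, rfl⟩
    · rintro ⟨⟨x, y, z⟩, ⟨hxy, hyz⟩, h⟩
      cases h
      exact ⟨y, hxy, hyz⟩

theorem isLowerSemicontinuousRel_iter [TopologicalSpace X] {F : SetRel X X}
    (hF : IsLowerSemicontinuousRel F) (n : ℕ) : IsLowerSemicontinuousRel (iter F n) := by
  induction n with
  | zero =>
    intro V hV
    have hid : {x | ∃ y ∈ V, (x, y) ∈ iter F 0} = V := by
      ext x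
      simp [iter]
    rwa [hid]
  | succ n ih => exact ih.comp hF

variable [MetricSpace X]

/-- The pairs `(x, y)` such that some point of `R(x)` has distance greater than `α` to `R(y)`. -/
def separatedPairs (R : SetRel X X) (α : ℝ) : Set (X × X) :=
  {p | ∃ β > α, ∃ z ∈ val R p.1, ∀ w ∈ val R p.2, β < dist z w}

theorem mem_separatedPairs_of_lt_hausdorffDist {R : SetRel X X} {α : ℝ} (hα : 0 ≤ α) {x y : X}
    (h : α < Metric.hausdorffDist (val R x) (val R y)) :
    (x, y) ∈ separatedPairs R α ∨ (y, x) ∈ separatedPairs R α := by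
  -- If both one-sided excesses were at most `β`, so would be the Hausdorff distance.
  obtain ⟨β, hβ, hβ'⟩ := exists_between h
  by_contra! hcon
  refine absurd (Metric.hausdorffDist_le_of_mem_dist (hα.trans hβ.le) ?_ ?_) (not_le.2 hβ')
  · intro z hz
    by_contra! hw
    exact hcon.1 ⟨β, hβ, z, hz, hw⟩
  · intro z hz
    by_contra! hw
    exact hcon.2 ⟨β, hβ, z, hz, hw⟩

variable [CompactSpace X]

/-- Excludes the default value `0` of `hausdorffDist`, so that small distances really provide nearby
points. -/
theorem hausdorffEDist_val_ne_top {F : SetRel X X} (hF : IsSetValuedMap F) (x y : X) :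
    Metric.hausdorffEDist (val F x) (val F y) ≠ ⊤ :=
  Metric.hausdorffEDist_ne_top_of_nonempty_of_bounded (hF x) (hF y)
    Metric.isBounded_of_compactSpace Metric.isBounded_of_compactSpace

theorem IsHausdorffContinuous.isClosed {F : SetRel X X} (hcont : IsHausdorffContinuous F)
    (hF : IsSetValuedMap F) (hclosed : ∀ x, IsClosed (val F x)) :
    IsClosed (F : Set (X × X)) := by
  rw [← isOpen_compl_iff, isOpen_iff_mem_nhds]
  rintro ⟨x, y⟩ hxy
  obtain ⟨r, hr, hball⟩ := Metric.isOpen_iff.1 (hclosed x).isOpen_compl y hxy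
  obtain ⟨δ, hδ, hd⟩ := hcont x (r / 2) (half_pos hr)
  filter_upwards [prod_mem_nhds (Metric.ball_mem_nhds x hδ)
    (Metric.ball_mem_nhds y (half_pos hr))]
  rintro ⟨x', y'⟩ ⟨hx', hy'⟩ hmem
  obtain ⟨w, hw, hwy⟩ := Metric.exists_dist_lt_of_hausdorffDist_lt' (y := y') hmem
    (hd x' (by rw [dist_comm]; exact hx')) (hausdorffEDist_val_ne_top hF x x')
  refine hball (a := w) ?_ hw
  have hy'' : dist y' y < r / 2 := hy'
  have := dist_triangle w y' y
  rw [Metric.mem_ball]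
  linarith

theorem IsHausdorffContinuous.isLowerSemicontinuousRel {F : SetRel X X}
    (hcont : IsHausdorffContinuous F) (hF : IsSetValuedMap F) : IsLowerSemicontinuousRel F := by
  intro V hV
  rw [isOpen_iff_mem_nhds]
  rintro x ⟨y, hyV, hxy⟩
  obtain ⟨r, hr, hball⟩ := Metric.isOpen_iff.1 hV y hyV
  obtain ⟨δ, hδ, hd⟩ := hcont x r hr
  filter_upwards [Metric.ball_mem_nhds x hδ] with x' hx'
  obtain ⟨w, hw, hwy⟩ := Metric.exists_dist_lt_of_hausdorffDist_lt (x := y) hxy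
    (hd x' (by rw [dist_comm]; exact hx')) (hausdorffEDist_val_ne_top hF x x')
  exact ⟨w, hball (by rwa [Metric.mem_ball, dist_comm]), hw⟩

/-- Lower semicontinuity lets `z` follow `x` within `η`; the closed graph keeps `R(y')` farther than
`β` from `z`. The margin `β > α` absorbs `η`. -/
theorem isOpen_separatedPairs {R : SetRel X X} (hRc : IsClosed (R : Set (X × X)))
    (hR : IsLowerSemicontinuousRel R) (α : ℝ) : IsOpen (separatedPairs R α) := by
  rw [isOpen_iff_mem_nhds]
  rintro ⟨x, y⟩ ⟨β, hβ, z, hz, hzw⟩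
  obtain ⟨η, hη, hαη⟩ : ∃ η > 0, α + 2 * η < β := ⟨(β - α) / 3, by linarith, by linarith⟩
  have hU := (hR (Metric.ball z η) Metric.isOpen_ball).mem_nhds
    ⟨z, Metric.mem_ball_self hη, hz⟩
  have hV : {y' | ∀ w ∈ val R y', β < dist z w} ∈ 𝓝 y := by
    have hcl : IsClosed (Prod.fst '' ((R : Set (X × X)) ∩ {p | dist z p.2 ≤ β})) :=
      ((hRc.inter (isClosed_le (by fun_prop) continuous_const)).isCompact.image
        continuous_fst).isClosed
    filter_upwards [hcl.isOpen_compl.mem_nhds (x := y) (by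
      rintro ⟨⟨_, w⟩, ⟨hw, hle⟩, rfl⟩
      exact absurd (hzw w hw) (not_lt.2 hle))] with y' hy' w hw
    exact lt_of_not_ge fun hle => hy' ⟨(y', w), ⟨hw, hle⟩, rfl⟩
  filter_upwards [prod_mem_nhds hU hV]
  rintro ⟨x', y'⟩ ⟨⟨z', hz', hz'R⟩, hy'⟩
  refine ⟨β - η, by linarith, z', hz'R, fun w hw => ?_⟩
  have h1 := hy' w hw
  have h2 : dist z' z < η := hz'
  have h3 := dist_triangle z z' w
  rw [dist_comm z z'] at h3
  linarith

/-- Positive expansiveness is uniform: distant points separate within a bounded time. -/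
theorem IsPositivelyExpansive.exists_bound {F : SetRel X X} {α : ℝ}
    (hexp : IsPositivelyExpansive F α) (hFc : IsClosed (F : Set (X × X)))
    (hF : IsLowerSemicontinuousRel F) {δ : ℝ} (hδ : 0 < δ) :
    ∃ N : ℕ, ∀ x y : X, δ ≤ dist x y → ∃ n ≤ N,
      (x, y) ∈ separatedPairs (iter F n) α ∨ (y, x) ∈ separatedPairs (iter F n) α := by
  have hS : IsCompact {p : X × X | δ ≤ dist p.1 p.2} :=
    (isClosed_le continuous_const (by fun_prop)).isCompact
  have hopen : ∀ n, IsOpen {p : X × X | p ∈ separatedPairs (iter F n) α ∨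
      p.swap ∈ separatedPairs (iter F n) α} := fun n =>
    have ho := isOpen_separatedPairs (isClosed_iter hFc n) (isLowerSemicontinuousRel_iter hF n) α
    ho.union (ho.preimage continuous_swap)
  obtain ⟨t, ht⟩ := hS.elim_finite_subcover _ hopen (by
    rintro ⟨x, y⟩ hxy
    obtain ⟨n, hn⟩ := hexp.separates x y (dist_pos.1 (hδ.trans_le hxy))
    exact Set.mem_iUnion.2 ⟨n, mem_separatedPairs_of_lt_hausdorffDist hexp.pos.le hn⟩)
  refine ⟨t.sup id, fun x y hxy => ?_⟩
  obtain ⟨n, hn, h⟩ := Set.mem_iUnion₂.1 (ht (show (x, y) ∈ _ from hxy))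
  exact ⟨n, Finset.le_sup (f := id) hn, h⟩

/-- A continuum whose points separate under `Fⁿ` contains, after time `n`, two continua that are
apart and of definite size. -/
theorem exists_two_continua {R : SetRel X X} (hRc : IsClosed (R : Set (X × X)))
    (hR : IsLowerSemicontinuousRel R) {α : ℝ} (hα : 0 < α) {A : Set X} (hAc : IsCompact A)
    (hA : IsPreconnected A) {x y : X} (hx : x ∈ A) (hy : y ∈ A)
    (hxy : (x, y) ∈ separatedPairs R α) :
    ∃ B : Bool → Set X, (∀ b, IsCompact (B b) ∧ IsPreconnected (B b) ∧
      (∀ w ∈ B b, ∃ a ∈ A, (a, w) ∈ R) ∧ ∃ u ∈ B b, ∃ v ∈ B b, α / 3 ≤ dist u v) ∧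
      ∀ b b', b ≠ b' → ∀ u ∈ B b, ∀ v ∈ B b', α / 4 < dist u v := by
  obtain ⟨β, hβ, z, hz, hzw⟩ := hxy
  obtain ⟨K, hKc, hK, hKA, hzK, w, hwK, hw⟩ := exists_continuum_image hRc hR hAc hA hx hy hz
  have hzw' : α < dist z w := hβ.trans (hzw w hw)
  have key : ∀ p ∈ K, ∀ q ∈ K, α < dist p q → ∃ B ⊆ K, IsClosed B ∧ IsPreconnected B ∧
      B ⊆ Metric.closedBall p (α / 3) ∧ p ∈ B ∧ ∃ y ∈ B, α / 3 ≤ dist p y :=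
    fun p hp q hq hpq =>
      exists_subcontinuum_closedBall hKc hK hp hq (by linarith) (by linarith)
  obtain ⟨B₁, hB₁K, hB₁c, hB₁, hB₁b, hz₁, u₁, hu₁, hd₁⟩ := key z hzK w hwK hzw'
  obtain ⟨B₂, hB₂K, hB₂c, hB₂, hB₂b, hz₂, u₂, hu₂, hd₂⟩ :=
    key w hwK z hzK (by rwa [dist_comm])
  -- Two radii `α / 3` leave more than `α / 3` of `dist z w > α`.
  have hsep : ∀ u ∈ B₁, ∀ v ∈ B₂, α / 4 < dist u v := by
    intro u hu v hv
    have h1 : dist u z ≤ α / 3 := hB₁b hu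
    have h2 : dist v w ≤ α / 3 := hB₂b hv
    have h3 := dist_triangle4 z u v w
    rw [dist_comm z u] at h3
    linarith
  refine ⟨fun b => cond b B₁ B₂, ?_, ?_⟩
  · rintro (_ | _)
    · exact ⟨hB₂c.isCompact, hB₂, fun w hw => hKA w (hB₂K hw), w, hz₂, u₂, hu₂, hd₂⟩
    · exact ⟨hB₁c.isCompact, hB₁, fun w hw => hKA w (hB₁K hw), z, hz₁, u₁, hu₁, hd₁⟩
  · rintro (_ | _) (_ | _) hb u hu v hv
    · exact absurd rfl hb
    · rw [dist_comm]
      exact hsep v hv u hu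
    · exact hsep u hu v hv
    · exact absurd rfl hb

end Iterates

/-! ### Orbits, branching and entropy -/

section Orbits

variable {X : Type*} {F : SetRel X X}

/-- Forward orbits of a relation. -/
def forwardOrbits (F : SetRel X X) : Set (ℕ → X) := {ω | ∀ i : ℕ, (ω i, ω (i + 1)) ∈ F}

theorem exists_mem_forwardOrbits (hF : IsSetValuedMap F) (x : X) :
    ∃ ω ∈ forwardOrbits F, ω 0 = x := by
  choose f hf using hF
  refine ⟨fun n => f^[n] x, fun n => ?_, rfl⟩
  change (f^[n] x, f^[n + 1] x) ∈ F
  rw [Function.iterate_succ_apply']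
  exact hf _

theorem exists_forwardOrbit_of_mem_iter {n : ℕ} {x : X} {ω : ℕ → X} (hω : ω ∈ forwardOrbits F)
    (h : (x, ω 0) ∈ iter F n) :
    ∃ τ ∈ forwardOrbits F, τ 0 = x ∧ ∀ i, τ (n + i) = ω i := by
  induction n generalizing ω with
  | zero =>
    have h' : x = ω 0 := h
    exact ⟨ω, hω, h'.symm, fun i => by rw [Nat.zero_add]⟩
  | succ n ih =>
    obtain ⟨w, hw, hw'⟩ := h
    obtain ⟨τ, hτ, hτ0, hτi⟩ := ih (ω := fun i => Nat.casesOn i w ω) (by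
      rintro (_ | i)
      · exact hw'
      · exact hω i) hw
    exact ⟨τ, hτ, hτ0, fun i => by rw [Nat.add_assoc, Nat.add_comm 1 i, hτi (i + 1)]⟩

theorem exists_suborbit_extending (hF : IsSetValuedMap F.inv) {ω : ℕ → X}
    (hω : ω ∈ forwardOrbits F) : ∃ τ ∈ suborbits F, ∀ i : ℕ, τ i = ω i := by
  obtain ⟨b, hb, hb0⟩ := exists_mem_forwardOrbits hF (ω 0)
  -- Negative times follow an orbit `b` of `F.inv` from `ω 0`; the shift is there because
  -- `Int.negSucc n` is `-(n + 1)`.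
  refine ⟨fun j => Int.casesOn j ω fun n => b (n + 1), ?_, fun i => rfl⟩
  rintro (i | _ | i)
  · exact hω i
  · have h := hb 0
    rw [hb0] at h
    exact h
  · exact hb (i + 1)

variable [MetricSpace X]

theorem le_maxSeparated (hF : IsSetValuedMap F.inv) {ι : Type*} [Fintype ι] {g : ι → ℕ → X}
    {ε : ℝ} {n : ℕ} (hε : 0 ≤ ε) (hg : ∀ s, g s ∈ forwardOrbits F)
    (hsep : ∀ s t, s ≠ t → ∃ i < n, ε < dist (g s i) (g t i)) :
    (Fintype.card ι : ℕ∞) ≤ maxSeparated F n ε := by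
  let G : ι → Fin n → X := fun s i => g s i
  have hG : ∀ s t, s ≠ t → ∃ i, ε < dist (G s i) (G t i) := fun s t hst =>
    let ⟨i, hi, h⟩ := hsep s t hst
    ⟨⟨i, hi⟩, h⟩
  have hinj : Function.Injective G := by
    intro s t hst
    by_contra hne
    obtain ⟨i, hi⟩ := hG s t hne
    rw [hst, dist_self] at hi
    exact absurd hi (not_lt.2 hε)
  refine le_iSup₂_of_le (Set.range G) ⟨?_, ?_⟩ ?_
  · rintro _ ⟨s, rfl⟩
    obtain ⟨τ, hτ, h⟩ := exists_suborbit_extending hF (hg s)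
    exact ⟨τ, hτ, fun i => (h i).symm⟩
  · rintro _ ⟨s, rfl⟩ _ ⟨t, rfl⟩ hst
    exact hG s t fun h => hst (h ▸ rfl)
  · rw [← Set.image_univ, hinj.encard_image, Set.encard_univ, ENat.card_eq_coe_fintype_card]

/-- If every set of a class `P` branches within time `N` into two sets of the class that are
more than `ε` apart, then orbits separate exponentially fast. -/
theorem exists_separated_family (hF : IsSetValuedMap F) {P : Set X → Prop} {N : ℕ} {ε : ℝ}
    (hP : ∀ A, P A → A.Nonempty)
    (hbranch : ∀ A, P A → ∃ n ≤ N, ∃ B : Bool → Set X,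
      (∀ b, P (B b) ∧ ∀ w ∈ B b, ∃ a ∈ A, (a, w) ∈ iter F n) ∧
      ∀ b b', b ≠ b' → ∀ u ∈ B b, ∀ v ∈ B b', ε < dist u v)
    (k : ℕ) {A : Set X} (hA : P A) :
    ∃ g : (Fin k → Bool) → ℕ → X, (∀ s, g s ∈ forwardOrbits F ∧ g s 0 ∈ A) ∧
      ∀ s t, s ≠ t → ∃ i ≤ k * N, ε < dist (g s i) (g t i) := by
  induction k generalizing A with
  | zero =>
    obtain ⟨x, hx⟩ := hP A hA
    obtain ⟨ω, hω, hω0⟩ := exists_mem_forwardOrbits hF x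
    have hωA : ω 0 ∈ A := by rwa [hω0]
    exact ⟨fun _ => ω, fun _ => ⟨hω, hωA⟩,
      fun s t hst => absurd (Subsingleton.elim s t) hst⟩
  | succ k ih =>
    obtain ⟨n, hn, B, hB, hBsep⟩ := hbranch A hA
    choose g hg hgsep using fun b => ih (hB b).1
    have hext : ∀ b s, ∃ τ ∈ forwardOrbits F, τ 0 ∈ A ∧ ∀ i, τ (n + i) = g b s i := by
      intro b s
      obtain ⟨a, ha, haw⟩ := (hB b).2 _ (hg b s).2
      obtain ⟨τ, hτ, hτ0, hτi⟩ := exists_forwardOrbit_of_mem_iter (hg b s).1 haw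
      exact ⟨τ, hτ, hτ0 ▸ ha, hτi⟩
    choose τ hτ hτA hτi using hext
    have hkN : (k + 1) * N = k * N + N := Nat.succ_mul k N
    refine ⟨fun s => τ (s 0) (Fin.tail s), fun s => ⟨hτ _ _, hτA _ _⟩, fun s t hst => ?_⟩
    by_cases h0 : s 0 = t 0
    · have htail : Fin.tail s ≠ Fin.tail t := fun h =>
        hst (by rw [← Fin.cons_self_tail s, ← Fin.cons_self_tail t, h0, h])
      obtain ⟨i, hi, hd⟩ := hgsep (t 0) _ _ htail
      refine ⟨n + i, by omega, ?_⟩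
      simp only [h0, hτi]
      exact hd
    -- Different first choices: at time `n` the orbits lie in different sets `B b`.
    · refine ⟨n + 0, by omega, ?_⟩
      simp only [hτi]
      exact hBsep _ _ h0 _ (hg _ _).2 _ (hg _ _).2

theorem separatedGrowth_pos {ε : ℝ} {N : ℕ}
    (h : ∀ k n : ℕ, k * N < n → ((2 ^ k : ℕ) : ℕ∞) ≤ maxSeparated F n ε) :
    0 < separatedGrowth F ε := by
  have hlog : ENNReal.log 2 = (Real.log 2 : EReal) := by
    simpa using ENNReal.log_ofReal_of_pos (x := 2) two_pos
  have hpos : (0 : EReal) < ((Real.log 2 / (N + 1 : ℝ) : ℝ) : EReal) := by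
    have := Real.log_pos one_lt_two
    exact EReal.coe_pos.2 (by positivity)
  -- With `k = a + 1` and length `k * (N + 1)`, the `+ 1` makes `k * N` strictly smaller and the
  -- length positive even if `N = 0`.
  refine hpos.trans_le (le_limsup_of_frequently_le' (frequently_atTop.2 fun a =>
    ⟨(a + 1) * (N + 1), by nlinarith, ?_⟩))
  have hn : 0 < (a + 1) * (N + 1) := by positivity
  rw [EReal.le_div_iff_mul_le (by exact_mod_cast hn) (EReal.natCast_ne_top _)]
  have hcard := ENat.toENNReal_le.2 (h (a + 1) ((a + 1) * (N + 1)) (by nlinarith))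
  refine le_trans (le_of_eq ?_) (ENNReal.log_monotone hcard)
  have hpow : (((2 ^ (a + 1) : ℕ) : ℕ∞) : ENNReal) = 2 ^ (a + 1) := by simp
  rw [hpow, ENNReal.log_pow, hlog]
  have hreal : Real.log 2 / (N + 1 : ℝ) * ((a + 1) * (N + 1) : ℕ) =
      ((a + 1 : ℕ) : ℝ) * Real.log 2 := by
    push_cast
    field_simp
  exact_mod_cast congrArg Real.toEReal hreal

theorem separatedGrowth_le_topEntropy {ε : ℝ} (hε : 0 < ε) :
    separatedGrowth F ε ≤ topEntropy F := by
  refine ge_of_tendsto (tendsto_separatedGrowth F) ?_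
  filter_upwards [Ioc_mem_nhdsGT hε] with ε' hε'
  exact separatedGrowth_antitone F hε'.2

end Orbits

end SetValued

open SetValued in
/-- The alternative `h` and local connectedness are not used: for an arbitrary continuous `F` with
closed values, `exists_continuum_image` provides large continua in the iterated images of a
continuum, which suffices for the exponential growth of separated orbits. -/
theorem theoremA {X : Type*} [MetricSpace X] [CompactSpace X] [ConnectedSpace X]
    [LocallyConnectedSpace X] [Nontrivial X]
    (F : SetRel X X) (α : ℝ)
    (hclosed : ∀ x, IsClosed (SetValued.val F x))
    (hcont : SetValued.IsHausdorffContinuous F)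
    (hexp : SetValued.IsPositivelyExpansive F α)
    (h : (∀ x, SetValued.IsContinuum (SetValued.val F x)) ∨
      (IsClosed (SetValued.iterateImages F) ∨ IsClosed (SetValued.forwardImages F))) :
    0 < SetValued.topEntropy F := by
  have hF := hexp.surjective.1
  have hα := hexp.pos
  have hFc := hcont.isClosed hF hclosed
  have hlsc := hcont.isLowerSemicontinuousRel hF
  obtain ⟨x₀, y₀, hxy₀⟩ := exists_pair_ne X
  obtain ⟨n₀, hn₀⟩ := hexp.separates x₀ y₀ hxy₀
  let P : Set X → Prop := fun A =>
    IsCompact A ∧ IsPreconnected A ∧ ∃ u ∈ A, ∃ v ∈ A, α / 3 ≤ dist u v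
  obtain ⟨N, hN⟩ := hexp.exists_bound hFc hlsc (δ := α / 3) (by linarith)
  have hbranch : ∀ n, ∀ A : Set X, IsCompact A → IsPreconnected A → ∀ x ∈ A, ∀ y ∈ A,
      ((x, y) ∈ separatedPairs (iter F n) α ∨ (y, x) ∈ separatedPairs (iter F n) α) →
      ∃ B : Bool → Set X, (∀ b, P (B b) ∧ ∀ w ∈ B b, ∃ a ∈ A, (a, w) ∈ iter F n) ∧
        ∀ b b', b ≠ b' → ∀ u ∈ B b, ∀ v ∈ B b', α / 4 < dist u v := by
    intro n A hAc hA x hx y hy hxy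
    have two : ∀ x ∈ A, ∀ y ∈ A, (x, y) ∈ separatedPairs (iter F n) α → _ :=
      fun x hx y hy => exists_two_continua (isClosed_iter hFc n)
        (isLowerSemicontinuousRel_iter hlsc n) hα hAc hA hx hy
    obtain ⟨B, hB, hsep⟩ := hxy.elim (two x hx y hy) (two y hy x hx)
    exact ⟨B, fun b => ⟨⟨(hB b).1, (hB b).2.1, (hB b).2.2.2⟩, (hB b).2.2.1⟩, hsep⟩
  -- Branching the whole space yields a root of the tree in `P`; the time `n₀` does not enter the
  -- growth rate.
  obtain ⟨B, hB, -⟩ := hbranch n₀ Set.univ isCompact_univ isPreconnected_univ x₀ trivial y₀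
    trivial (mem_separatedPairs_of_lt_hausdorffDist hα.le hn₀)
  refine (separatedGrowth_pos (F := F) (ε := α / 4) (N := N) fun k n hkn => ?_).trans_le
    (separatedGrowth_le_topEntropy (by linarith))
  obtain ⟨g, hg, hsep⟩ := exists_separated_family hF (P := P) (N := N) (ε := α / 4)
    (fun A hA => let ⟨u, hu, _⟩ := hA.2.2; ⟨u, hu⟩)
    (fun A hA => by
      obtain ⟨hAc, hA, x, hx, y, hy, hxy⟩ := hA
      obtain ⟨m, hm, hsep⟩ := hN x y hxy
      exact ⟨m, hm, hbranch m A hAc hA x hx y hy hsep⟩) k (hB true).1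
  have hcard := le_maxSeparated hexp.surjective.2 (n := n) (by linarith) (fun s => (hg s).1)
    fun s t hst => let ⟨i, hi, hd⟩ := hsep s t hst; ⟨i, hi.trans_lt hkn, hd⟩
  simpa using hcard
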